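/- Let $p\ge 2$ be a real number and let $E$ be a (real) Banach lattice. Recall the following notions. - $E$ has \emph{cotype} $p$ if there is a constant $C>0$ such that for all $n$ and all $x_1,\dots,x_n\in E$, $$\Big(\sum_{k=1}^n\|x_k\|^p\Big)^{1/p}\le C\Big(\int_0^1\Big\|\sum_{k=1}^n r_k(t)x_k\Big\|^2\,dt\Big)^{1/2},$$ where $r_k(t)=\operatorname{sign}(\sin(2^k\pi t))$ are the Rademacher functions. - A sequence $(x_n)_n$ in a Banach lattice $F$ is \emph{disjoint} if $|x_n|\wedge|x_m|=0$ for $n\ne m$, and \emph{weakly $p$-summable} if $\sum_n|f(x_n)|^p<\infty$ for every $f\in F^*$. - $F$ has the \emph{disjoint Dunford--Pettis property of order $p$} (disjoint $DPP_p$) if for every disjoint weakly $p$-summable sequence $(x_n)_n$ in $F$ the set $\{x_n:n\in\mathbb N\}$ is a Dunford--Pettis set, that is, $\sup_{k}|f_n(x_k)|\to 0$ as $n\to\infty$ for every weakly null sequence $(f_n)_n$ in $F^*$. The dual $E^*$ is a Banach lattice in the dual order: $f\le g$ iff $f(x)\le g(x)$ for all $x\ge 0$ in $E$. If $E$ has cotype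 $p$ and $E^*$ has the disjoint $DPP_p$, then $E$ has the disjoint $DPP_p$. -/

import Mathlib

open Filter Topology Set

/-! ### The dual of a Banach lattice as a vector lattice -/

noncomputable section DualLattice

namespace StrongDual

variable {E : Type*} [NormedAddCommGroup E] [NormedSpace ℝ E] [Lattice E] [HasSolidNorm E]
  [IsOrderedAddMonoid E]

/-- `sup {f y : 0 ≤ y ≤ x}`, the value of the positive part of `f` at `x ≥ 0`. -/
def posSup (f : StrongDual ℝ E) (x : E) : ℝ := sSup (f '' Icc 0 x)

theorem le_norm_mul_of_mem_Icc (f : StrongDual ℝ E) {x y : E} (hy : y ∈ Icc 0 x) :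
    f y ≤ ‖f‖ * ‖x‖ := by
  have h1 : ‖y‖ ≤ ‖x‖ := by
    apply norm_le_norm_of_abs_le_abs
    rw [abs_of_nonneg hy.1, abs_of_nonneg (hy.1.trans hy.2)]
    exact hy.2
  calc f y ≤ ‖f y‖ := Real.le_norm_self _
    _ ≤ ‖f‖ * ‖y‖ := f.le_opNorm y
    _ ≤ ‖f‖ * ‖x‖ := by gcongr

theorem le_posSup (f : StrongDual ℝ E) {x y : E} (h0 : 0 ≤ y) (h : y ≤ x) :
    f y ≤ posSup f x := by
  refine le_csSup ⟨‖f‖ * ‖x‖, ?_⟩ (mem_image_of_mem f ⟨h0, h⟩)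
  rintro _ ⟨z, hz, rfl⟩
  exact le_norm_mul_of_mem_Icc f hz

theorem posSup_le (f : StrongDual ℝ E) {x : E} (hx : 0 ≤ x) {c : ℝ}
    (h : ∀ y, 0 ≤ y → y ≤ x → f y ≤ c) : posSup f x ≤ c := by
  refine csSup_le ⟨f 0, mem_image_of_mem f ⟨le_rfl, hx⟩⟩ ?_
  rintro _ ⟨z, hz, rfl⟩
  exact h z hz.1 hz.2

theorem posSup_nonneg (f : StrongDual ℝ E) {x : E} (hx : 0 ≤ x) : 0 ≤ posSup f x := by
  simpa using le_posSup f le_rfl hx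

theorem posSup_add (f : StrongDual ℝ E) {a b : E} (ha : 0 ≤ a) (hb : 0 ≤ b) :
    posSup f (a + b) = posSup f a + posSup f b := by
  apply le_antisymm
  · refine posSup_le f (add_nonneg ha hb) fun y h0 h => ?_
    have h1 : 0 ≤ y - y ⊓ a := sub_nonneg.2 inf_le_left
    have h2 : y - y ⊓ a ≤ b := by
      rw [sub_le_comm]
      refine le_inf (sub_le_self y hb) ?_
      rwa [sub_le_iff_le_add]
    have h3 := le_posSup f (le_inf h0 ha) (inf_le_right : y ⊓ a ≤ a)
    have h4 := le_posSup f h1 h2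
    rw [map_sub] at h4
    linarith
  · rw [← le_sub_iff_add_le]
    refine posSup_le f ha fun y h0 h => ?_
    rw [le_sub_comm]
    refine posSup_le f hb fun z h0' h' => ?_
    have := le_posSup f (add_nonneg h0 h0') (add_le_add h h')
    rw [map_add] at this
    linarith

theorem posSup_sub_posSup (f : StrongDual ℝ E) {a b c d : E} (ha : 0 ≤ a) (hb : 0 ≤ b)
    (hc : 0 ≤ c) (hd : 0 ≤ d) (h : a - b = c - d) :
    posSup f a - posSup f b = posSup f c - posSup f d := by
  have h1 : a + d = c + b := by
    rw [sub_eq_sub_iff_add_eq_add] at h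
    exact h
  have h2 := posSup_add f ha hd
  rw [h1, posSup_add f hc hb] at h2
  linarith

/-- The positive part of `f`: the additive extension of `posSup f` from the positive cone. -/
def posPartAddHom (f : StrongDual ℝ E) : E →+ ℝ :=
  AddMonoidHom.mk' (fun x => posSup f (x ⊔ 0) - posSup f (-x ⊔ 0)) fun x y => by
    have e : ∀ z : E, (z ⊔ 0) - (-z ⊔ 0) = z := fun z => posPart_sub_negPart z
    have hn : ∀ z : E, 0 ≤ z ⊔ 0 := fun z => le_sup_right
    have h := posSup_sub_posSup f (hn (x + y)) (hn (-(x + y))) (add_nonneg (hn x) (hn y))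
      (add_nonneg (hn (-x)) (hn (-y))) (by
        rw [e, add_sub_add_comm, e, e])
    rw [h, posSup_add f (hn x) (hn y), posSup_add f (hn (-x)) (hn (-y))]
    ring

theorem abs_posPartAddHom_le (f : StrongDual ℝ E) (x : E) :
    ‖posPartAddHom f x‖ ≤ ‖f‖ * ‖x‖ := by
  have key : ∀ z : E, 0 ≤ posSup f (z ⊔ 0) ∧ posSup f (z ⊔ 0) ≤ ‖f‖ * ‖z‖ := by
    intro z
    refine ⟨posSup_nonneg f le_sup_right, posSup_le f le_sup_right fun y h0 h => ?_⟩
    have := le_norm_mul_of_mem_Icc f (x := |z|) ⟨h0, h.trans (sup_le (le_abs_self z) (abs_nonneg z))⟩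
    rwa [norm_abs_eq_norm] at this
  have h1 := key x
  have h2 := key (-x)
  rw [norm_neg] at h2
  change |posSup f (x ⊔ 0) - posSup f (-x ⊔ 0)| ≤ _
  rw [abs_le]
  constructor <;> linarith

/-- The positive part `f⁺` of a continuous functional `f`, with `f⁺ x = sup {f y : 0 ≤ y ≤ x}`
for `x ≥ 0`. -/
def positivePart (f : StrongDual ℝ E) : StrongDual ℝ E :=
  (posPartAddHom f).toRealLinearMap
    (AddMonoidHomClass.continuous_of_bound (posPartAddHom f) ‖f‖ (abs_posPartAddHom_le f))

theorem positivePart_apply (f : StrongDual ℝ E) {x : E} (hx : 0 ≤ x) :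
    positivePart f x = posSup f x := by
  change posSup f (x ⊔ 0) - posSup f (-x ⊔ 0) = _
  have h0 : posSup f (0 : E) = 0 :=
    le_antisymm (posSup_le f le_rfl fun y h h' => by simp [le_antisymm h' h])
      (posSup_nonneg f le_rfl)
  rw [sup_of_le_left hx, sup_of_le_right (neg_nonpos.2 hx), h0, sub_zero]

/-- The dual order: `f ≤ g` iff `f x ≤ g x` for all `x ≥ 0`. -/
instance instPartialOrder : PartialOrder (StrongDual ℝ E) where
  le f g := ∀ x : E, 0 ≤ x → f x ≤ g x
  le_refl _ _ _ := le_rfl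
  le_trans _ _ _ h h' x hx := (h x hx).trans (h' x hx)
  le_antisymm f g h h' := by
    have key : ∀ x : E, 0 ≤ x → f x = g x := fun x hx => le_antisymm (h x hx) (h' x hx)
    ext x
    rw [← posPart_sub_negPart x, map_sub, map_sub, key _ (posPart_nonneg x),
      key _ (negPart_nonneg x)]

theorem le_def (f g : StrongDual ℝ E) : f ≤ g ↔ ∀ x : E, 0 ≤ x → f x ≤ g x := Iff.rfl

/-- The dual of a normed vector lattice is a lattice in the dual order
(a partial order determines its suprema and infima). -/
instance instLattice : Lattice (StrongDual ℝ E) where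
  sup f g := g + positivePart (f - g)
  inf f g := f - positivePart (f - g)
  le_sup_left f g x hx := by
    have := le_posSup (f - g) hx le_rfl
    rw [add_apply, positivePart_apply _ hx]
    rw [sub_apply] at this
    linarith
  le_sup_right f g x hx := by
    have := posSup_nonneg (f - g) hx
    rw [add_apply, positivePart_apply _ hx]
    linarith
  sup_le f g h hf hg x hx := by
    rw [add_apply, positivePart_apply _ hx, ← le_sub_iff_add_le']
    refine posSup_le _ hx fun y h0 h' => ?_
    have h1 := hf y h0
    have h2 := hg (x - y) (sub_nonneg.2 h')
    rw [map_sub, map_sub] at h2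
    rw [sub_apply]
    linarith
  inf_le_left f g x hx := by
    have := posSup_nonneg (f - g) hx
    rw [sub_apply, positivePart_apply _ hx]
    linarith
  inf_le_right f g x hx := by
    have := le_posSup (f - g) hx le_rfl
    rw [sub_apply, positivePart_apply _ hx]
    rw [sub_apply] at this
    linarith
  le_inf h f g hf hg x hx := by
    rw [sub_apply, positivePart_apply _ hx, le_sub_comm]
    refine posSup_le _ hx fun y h0 h' => ?_
    have h1 := hg y h0
    have h2 := hf (x - y) (sub_nonneg.2 h')
    rw [map_sub, map_sub] at h2
    rw [sub_apply]
    linarith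

end StrongDual

end DualLattice

/-! ### Cotype -/

noncomputable section Cotype

/-- The `n`-th Rademacher function `r_n(t) = sign (sin (2 ^ n * π * t))`, for `n ≥ 1`. -/
def rademacher (n : ℕ) (t : ℝ) : ℝ := Real.sign (Real.sin (2 ^ n * Real.pi * t))

/-- `X` has cotype `p` (a notion used for `2 ≤ p < ∞`). -/
def HasCotype (X : Type*) [NormedAddCommGroup X] [NormedSpace ℝ X] (p : ℝ) : Prop :=
  ∃ C : ℝ, 0 < C ∧ ∀ (n : ℕ) (x : Fin n → X),
    (∑ k, ‖x k‖ ^ p) ^ (1 / p) ≤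
      C * (∫ t in (0 : ℝ)..1, ‖∑ k : Fin n, rademacher (k + 1) t • x k‖ ^ 2) ^ (1 / 2 : ℝ)

end Cotype

/-! ### The disjoint Dunford-Pettis property of order `p` -/

section DunfordPettis

variable {X : Type*} [NormedAddCommGroup X] [NormedSpace ℝ X]

/-- The sequence `x` converges to `0` in the weak topology of `X`. -/
def IsWeaklyNull (x : ℕ → X) : Prop :=
  Tendsto (fun n => toWeakSpace ℝ X (x n)) atTop (𝓝 0)

/-- The sequence `(f (x n))` is in `ℓ_p` for every continuous functional `f`. -/
def IsWeaklySummable (p : ℝ) (x : ℕ → X) : Prop :=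
  ∀ f : StrongDual ℝ X, Summable fun n => |f (x n)| ^ p

/-- Every weakly null sequence of functionals converges to zero uniformly on `A`. -/
def IsDunfordPettisSet (A : Set X) : Prop :=
  ∀ f : ℕ → StrongDual ℝ X, IsWeaklyNull f →
    TendstoUniformlyOn (fun n x => f n x) (fun _ => 0) atTop A

/-- The terms of the sequence `x` are pairwise disjoint elements of the vector lattice. -/
def IsDisjointSeq {E : Type*} [AddGroup E] [Lattice E] (x : ℕ → E) : Prop :=
  ∀ m n, m ≠ n → |x m| ⊓ |x n| = 0

/-- Every disjoint weakly `p`-summable sequence in the Banach lattice `E` is Dunford-Pettis. -/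
def HasDisjointDPP (p : ℝ) (E : Type*) [NormedAddCommGroup E] [NormedSpace ℝ E] [Lattice E] :
    Prop :=
  ∀ x : ℕ → E, IsDisjointSeq x → IsWeaklySummable p x → IsDunfordPettisSet (range x)

end DunfordPettis

/-!
Cotype `p` yields a lower `p`-estimate `∑ ‖y k‖ ^ p ≤ C ^ p * ‖∑ y k‖ ^ p` for disjoint positive
`y k`. Let `x` be disjoint and weakly `p`-summable, and choose positive functionals `g n` in the
unit ball of the dual, norming `(x n)⁺` and carried by the band which `(x n)⁺` generates. These are
disjoint. For `y ≥ 0` the truncations `y ⊓ k • (x n)⁺` are disjoint elements below `y`, so the lower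
estimate gives `∑ g n y ^ p ≤ C ^ p * ‖y‖ ^ p`, and Helly's theorem extends this bound to the
bidual: `g` is weakly `p`-summable. The images of `x n` in the bidual are weakly null, so the
disjoint Dunford-Pettis property of the dual gives `‖(x n)⁺‖ ≤ g n (x n) → 0`. The same applies to
`-x`; hence `x n → 0` in norm, and the range of a norm-null sequence is a Dunford-Pettis set.
-/

section VectorLattice

variable {E : Type*} [AddCommGroup E] [Lattice E] {a b c : E}

theorem inf_eq_zero_of_le_of_le {d : E} (ha : 0 ≤ a) (hb : 0 ≤ b) (hac : a ≤ c) (hbd : b ≤ d)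
    (h : c ⊓ d = 0) : a ⊓ b = 0 :=
  le_antisymm (h ▸ inf_le_inf hac hbd) (le_inf ha hb)

variable [IsOrderedAddMonoid E]

theorem inf_add_le_inf_add_inf (ha : 0 ≤ a) (hb : 0 ≤ b) (hc : 0 ≤ c) :
    a ⊓ (b + c) ≤ a ⊓ b + a ⊓ c := by
  rw [add_inf, inf_add, inf_add]
  refine le_inf (le_inf ?_ ?_) (le_inf ?_ inf_le_right)
  · exact inf_le_left.trans (le_add_of_nonneg_left ha)
  · exact inf_le_left.trans (le_add_of_nonneg_left hb)
  · exact inf_le_left.trans (le_add_of_nonneg_right hc)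

theorem inf_add_eq_zero (hab : a ⊓ b = 0) (hac : a ⊓ c = 0) : a ⊓ (b + c) = 0 := by
  have ha : 0 ≤ a := hab ▸ inf_le_left
  have hb : 0 ≤ b := hab ▸ inf_le_right
  have hc : 0 ≤ c := hac ▸ inf_le_right
  refine le_antisymm ?_ (le_inf ha (add_nonneg hb hc))
  simpa only [hab, hac, add_zero] using inf_add_le_inf_add_inf ha hb hc

theorem inf_sum_eq_zero {ι : Type*} {s : Finset ι} {y : ι → E} (ha : 0 ≤ a)
    (h : ∀ i ∈ s, a ⊓ y i = 0) : a ⊓ ∑ i ∈ s, y i = 0 :=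
  Finset.sum_induction y (a ⊓ · = 0) (fun _ _ => inf_add_eq_zero) (inf_eq_right.2 ha) h

theorem inf_nsmul_eq_zero (h : a ⊓ b = 0) (k : ℕ) : a ⊓ k • b = 0 := by
  simpa only [Finset.sum_const, Finset.card_range] using
    inf_sum_eq_zero (s := Finset.range k) (h ▸ inf_le_left) fun _ _ => h

theorem nsmul_inf_eq_zero (h : a ⊓ b = 0) (k : ℕ) : k • a ⊓ b = 0 := by
  rw [inf_comm] at h ⊢
  exact inf_nsmul_eq_zero h k

theorem nsmul_inf_nsmul_eq_zero (h : a ⊓ b = 0) (k : ℕ) : k • a ⊓ k • b = 0 :=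
  nsmul_inf_eq_zero (inf_nsmul_eq_zero h k) k

theorem sum_le_of_pairwise_inf_eq_zero {ι : Type*} {s : Finset ι} {y : ι → E} (hb : 0 ≤ b)
    (h0 : ∀ i ∈ s, 0 ≤ y i) (hy : ∀ i ∈ s, y i ≤ b)
    (hd : (s : Set ι).Pairwise fun i j => y i ⊓ y j = 0) : ∑ i ∈ s, y i ≤ b := by
  classical
  induction s using Finset.induction_on with
  | empty => simpa only [Finset.sum_empty] using hb
  | insert i s hi ih =>
    simp only [Finset.forall_mem_insert] at h0 hy
    rw [Finset.coe_insert] at hd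
    have hdisj : y i ⊓ ∑ j ∈ s, y j = 0 := inf_sum_eq_zero h0.1 fun j hj =>
      hd (mem_insert i _) (mem_insert_of_mem i hj) (ne_of_mem_of_not_mem hj hi).symm
    calc ∑ j ∈ insert i s, y j = y i ⊔ ∑ j ∈ s, y j := by
          rw [Finset.sum_insert hi, ← inf_add_sup, hdisj, zero_add]
      _ ≤ b := sup_le hy.1 (ih h0.2 hy.2 (hd.mono (subset_insert i _)))

theorem abs_sign_smul_le [Module ℝ E] (hb : 0 ≤ b) (r : ℝ) : |Real.sign r • b| ≤ b := by
  rcases Real.sign_apply_eq r with h | h | h <;> simp [h, abs_of_nonneg hb, hb]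

theorem posPart_le_abs (a : E) : a⁺ ≤ |a| := sup_le (le_abs_self a) (abs_nonneg a)

theorem negPart_le_abs (a : E) : a⁻ ≤ |a| := sup_le (neg_le_abs a) (abs_nonneg a)

end VectorLattice

section LowerEstimate

/-- `E` satisfies a lower `p`-estimate: `(∑ ‖x k‖ ^ p) ^ (1 / p) ≤ C * ‖∑ x k‖` for pairwise
disjoint `x k`. The estimate for positive elements contains the general one, since
`|∑ x k| = ∑ |x k|` for disjoint `x k`. -/
def HasLowerEstimate (E : Type*) [NormedAddCommGroup E] [Lattice E] (p : ℝ) : Prop :=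
  ∃ C : ℝ, 0 < C ∧ ∀ (n : ℕ) (x : Fin n → E), (∀ k, 0 ≤ x k) →
    Pairwise (fun i j => x i ⊓ x j = 0) → (∑ k, ‖x k‖ ^ p) ^ (1 / p) ≤ C * ‖∑ k, x k‖

variable {E : Type*} [NormedAddCommGroup E] [Lattice E] [HasSolidNorm E] [IsOrderedAddMonoid E]
  {p : ℝ}

theorem norm_le_norm_of_nonneg_of_le {a b : E} (ha : 0 ≤ a) (hab : a ≤ b) : ‖a‖ ≤ ‖b‖ :=
  norm_le_norm_of_abs_le_abs (abs_le_abs_of_nonneg ha hab)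

theorem norm_posPart_le_norm (x : E) : ‖x⁺‖ ≤ ‖x‖ :=
  norm_abs_eq_norm x ▸ norm_le_norm_of_nonneg_of_le (posPart_nonneg x) (posPart_le_abs x)

theorem norm_negPart_le_norm (x : E) : ‖x⁻‖ ≤ ‖x‖ :=
  norm_abs_eq_norm x ▸ norm_le_norm_of_nonneg_of_le (negPart_nonneg x) (negPart_le_abs x)

theorem HasLowerEstimate.exists_sum_rpow_norm_le (hp : 0 < p) (hE : HasLowerEstimate E p) :
    ∃ C : ℝ, 0 < C ∧ ∀ (n : ℕ) (y : Fin n → E) (b : E), 0 ≤ b → (∀ k, 0 ≤ y k) →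
      (∀ k, y k ≤ b) → Pairwise (fun i j => y i ⊓ y j = 0) →
      ∑ k, ‖y k‖ ^ p ≤ (C * ‖b‖) ^ p := by
  obtain ⟨C, hC, h⟩ := hE
  refine ⟨C, hC, fun n y b hb h0 hy hd => ?_⟩
  rw [← Real.rpow_inv_le_iff_of_pos (by positivity) (by positivity) hp, ← one_div]
  have hsum : ∑ k, y k ≤ b := sum_le_of_pairwise_inf_eq_zero hb (fun k _ => h0 k)
    (fun k _ => hy k) (hd.set_pairwise _)
  refine (h n y h0 hd).trans ?_
  gcongr
  exact norm_le_norm_of_nonneg_of_le (Finset.sum_nonneg fun k _ => h0 k) hsum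

variable [NormedSpace ℝ E]

theorem norm_sum_rademacher_smul_le {n : ℕ} {x : Fin n → E} (hx : ∀ k, 0 ≤ x k) (t : ℝ) :
    ‖∑ k : Fin n, rademacher (k + 1) t • x k‖ ≤ ‖∑ k, x k‖ := by
  apply norm_le_norm_of_abs_le_abs
  rw [abs_of_nonneg (Finset.sum_nonneg fun k _ => hx k)]
  calc |∑ k : Fin n, rademacher (k + 1) t • x k|
      ≤ ∑ k : Fin n, |rademacher (k + 1) t • x k| :=
        Finset.le_sum_of_subadditive _ abs_zero.le abs_add_le _ _
    _ ≤ ∑ k, x k := Finset.sum_le_sum fun k _ => abs_sign_smul_le (hx k) _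

theorem HasCotype.hasLowerEstimate (h : HasCotype E p) : HasLowerEstimate E p := by
  obtain ⟨C, hC, h⟩ := h
  refine ⟨C, hC, fun n x hx _ => (h n x).trans (mul_le_mul_of_nonneg_left ?_ hC.le)⟩
  have hint : ∫ t in (0 : ℝ)..1, ‖∑ k : Fin n, rademacher (k + 1) t • x k‖ ^ 2
      ≤ ‖∑ k, x k‖ ^ 2 := by
    have hbound := intervalIntegral.norm_integral_le_of_norm_le_const (a := (0 : ℝ)) (b := 1)
      (f := fun t => ‖∑ k : Fin n, rademacher (k + 1) t • x k‖ ^ 2) (C := ‖∑ k, x k‖ ^ 2)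
      fun t _ => by
        rw [norm_pow, norm_norm]
        gcongr
        exact norm_sum_rademacher_smul_le hx t
    rw [sub_zero, abs_one, mul_one] at hbound
    exact (Real.le_norm_self _).trans hbound
  rw [← Real.sqrt_eq_rpow]
  exact Real.sqrt_le_iff.2 ⟨norm_nonneg _, hint⟩

end LowerEstimate

section WeakTopology

variable {X : Type*} [NormedAddCommGroup X] [NormedSpace ℝ X] {x : ℕ → X} {p : ℝ}

open NormedSpace (inclusionInDoubleDual inclusionInDoubleDualLi)

theorem isWeaklyNull_iff :
    IsWeaklyNull x ↔ ∀ f : StrongDual ℝ X, Tendsto (fun n => f (x n)) atTop (𝓝 0) := by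
  have hinj : Function.Injective (topDualPairing ℝ X).flip := fun a b hab =>
    (SeparatingDual.eq_iff_forall_dual_eq (R := ℝ)).2 fun f => LinearMap.congr_fun hab f
  refine (WeakBilin.tendsto_iff_forall_eval_tendsto _ hinj).trans (forall_congr' fun f => ?_)
  change Tendsto (fun n => f (x n)) atTop (𝓝 (f 0)) ↔ _
  rw [map_zero]

theorem IsWeaklyNull.exists_norm_le (hx : IsWeaklyNull x) : ∃ M, ∀ n, ‖x n‖ ≤ M := by
  obtain ⟨M, hM⟩ := banach_steinhaus (g := fun n => inclusionInDoubleDual ℝ X (x n)) fun f => by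
    obtain ⟨C, hC⟩ := (isWeaklyNull_iff.1 hx f).norm.bddAbove_range
    exact ⟨C, fun n => hC ⟨n, rfl⟩⟩
  exact ⟨M, fun n => ((inclusionInDoubleDualLi ℝ).norm_map (x n)).symm.trans_le (hM n)⟩

theorem isDunfordPettisSet_range_of_tendsto_zero (hx : Tendsto x atTop (𝓝 0)) :
    IsDunfordPettisSet (range x) := by
  intro f hf
  obtain ⟨M, hM⟩ := hf.exists_norm_le
  rw [Metric.tendstoUniformlyOn_iff]
  intro ε hε
  have htail : ∀ᶠ k in atTop, M * ‖x k‖ < ε := by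
    have h : Tendsto (fun k => M * ‖x k‖) atTop (𝓝 0) := by
      simpa only [norm_zero, mul_zero] using hx.norm.const_mul M
    exact h.eventually_lt_const hε
  obtain ⟨K, hK⟩ := eventually_atTop.1 htail
  have hhead : ∀ᶠ n in atTop, ∀ k ∈ Finset.range K, ‖f n (x k)‖ < ε := by
    refine (eventually_all_finset _).2 fun k _ => ?_
    have h := (isWeaklyNull_iff.1 hf (inclusionInDoubleDual ℝ X (x k))).norm
    rw [norm_zero] at h
    exact h.eventually_lt_const hε
  filter_upwards [hhead] with n hn
  rintro _ ⟨k, rfl⟩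
  rw [dist_zero_left]
  rcases lt_or_ge k K with hk | hk
  · exact hn k (Finset.mem_range.2 hk)
  · exact ((f n).le_of_opNorm_le (hM n) (x k)).trans_lt (hK k hk)

theorem IsWeaklySummable.tendsto_apply (hp : 0 < p) (hx : IsWeaklySummable p x)
    (f : StrongDual ℝ X) : Tendsto (fun n => f (x n)) atTop (𝓝 0) := by
  rw [tendsto_zero_iff_abs_tendsto_zero]
  have h := (hx f).tendsto_atTop_zero.rpow_const (p := p⁻¹) (Or.inr (by positivity))
  rw [Real.zero_rpow (by positivity)] at h
  exact h.congr fun n => Real.rpow_rpow_inv (abs_nonneg _) hp.ne'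

theorem IsWeaklySummable.isWeaklyNull_inclusionInDoubleDual (hp : 0 < p)
    (hx : IsWeaklySummable p x) : IsWeaklyNull fun n => inclusionInDoubleDual ℝ X (x n) :=
  isWeaklyNull_iff.2 fun Φ => hx.tendsto_apply hp (Φ.comp (inclusionInDoubleDual ℝ X))

theorem apply_comp_pi {ι : Type*} [Finite ι] (φ : StrongDual ℝ (StrongDual ℝ X))
    (g : ι → StrongDual ℝ X) (ℓ : StrongDual ℝ (ι → ℝ)) :
    φ (ℓ.comp (ContinuousLinearMap.pi g)) = ℓ fun i => φ (g i) := by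
  classical
  cases nonempty_fintype ι
  have hℓ : ∀ v : ι → ℝ, ℓ v = ∑ i, v i * ℓ (fun j => if i = j then 1 else 0) := fun v =>
    LinearMap.pi_apply_eq_sum_univ ℓ.toLinearMap v
  have hcomp : ℓ.comp (ContinuousLinearMap.pi g) =
      ∑ i, ℓ (fun j => if i = j then 1 else 0) • g i := by
    ext y
    change ℓ (fun i => g i y) = _
    simp [hℓ (fun i => g i y), mul_comm]
  rw [hcomp, hℓ, map_sum]
  simp only [map_smul, smul_eq_mul, mul_comm]

theorem norm_mul_le_of_forall_apply_le {f : StrongDual ℝ X} {r s : ℝ} (hr : 0 ≤ r)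
    (h : ∀ y, ‖y‖ ≤ r → f y ≤ s) : ‖f‖ * r ≤ s := by
  rcases hr.eq_or_lt with rfl | hr
  · simpa using h 0 norm_zero.le
  · rw [← le_div_iff₀ hr]
    refine ContinuousLinearMap.opNorm_bound_of_ball_bound hr s f fun y hy => ?_
    have hy : ‖y‖ ≤ r := mem_closedBall_zero_iff.1 hy
    exact abs_le'.2 ⟨h y hy, map_neg f y ▸ h (-y) ((norm_neg y).trans_le hy)⟩

-- Helly's theorem, a finite-dimensional form of Goldstine's.
theorem apply_mem_closure_image_closedBall {ι : Type*} [Finite ι] (g : ι → StrongDual ℝ X)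
    (φ : StrongDual ℝ (StrongDual ℝ X)) :
    (fun i => φ (g i)) ∈ closure ((fun y i => g i y) '' Metric.closedBall (0 : X) ‖φ‖) := by
  by_contra hmem
  have hconv : Convex ℝ ((fun y i => g i y) '' Metric.closedBall (0 : X) ‖φ‖) :=
    (convex_closedBall 0 ‖φ‖).linear_image (ContinuousLinearMap.pi g).toLinearMap
  obtain ⟨ℓ, s, hs, hsφ⟩ := geometric_hahn_banach_closed_point hconv.closure isClosed_closure hmem
  let f : StrongDual ℝ X := ℓ.comp (ContinuousLinearMap.pi g)
  have hfs : ∀ y, ‖y‖ ≤ ‖φ‖ → f y ≤ s := fun y hy =>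
    (hs _ (subset_closure (mem_image_of_mem _ (mem_closedBall_zero_iff.2 hy)))).le
  have hφs : φ f ≤ s := calc
    φ f ≤ ‖φ‖ * ‖f‖ := (Real.le_norm_self _).trans (φ.le_opNorm f)
    _ = ‖f‖ * ‖φ‖ := mul_comm _ _
    _ ≤ s := norm_mul_le_of_forall_apply_le (norm_nonneg φ) hfs
  rw [← apply_comp_pi] at hsφ
  exact hφs.not_gt hsφ

theorem isWeaklySummable_of_sum_rpow_le {K : ℝ} (hp : 0 < p) (hK : 0 ≤ K)
    {g : ℕ → StrongDual ℝ X}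
    (hg : ∀ (N : ℕ) (y : X), ∑ n : Fin N, |g n y| ^ p ≤ (K * ‖y‖) ^ p) :
    IsWeaklySummable p g := by
  intro φ
  refine summable_of_sum_range_le (c := (K * ‖φ‖) ^ p) (fun n => by positivity) fun N => ?_
  rw [← Fin.sum_univ_eq_sum_range (fun n => |φ (g n)| ^ p)]
  have hclosed : IsClosed {v : Fin N → ℝ | ∑ n, |v n| ^ p ≤ (K * ‖φ‖) ^ p} :=
    isClosed_le (continuous_finsetSum _ fun n _ =>
      (continuous_apply n).abs.rpow_const fun _ => Or.inr hp.le) continuous_const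
  refine closure_minimal ?_ hclosed (apply_mem_closure_image_closedBall (fun n : Fin N => g n) φ)
  rintro _ ⟨y, hy, rfl⟩
  refine (hg N y).trans ?_
  gcongr
  exact mem_closedBall_zero_iff.1 hy

end WeakTopology

section PositiveFunctional

variable {E : Type*} [NormedAddCommGroup E] [NormedSpace ℝ E] [Lattice E] [IsOrderedAddMonoid E]
  {g h : StrongDual ℝ E} {u : E}

theorem monotone_of_dual_nonneg (hg : 0 ≤ g) : Monotone g := fun a b hab => by
  have h := hg (b - a) (sub_nonneg.2 hab)
  rwa [zero_apply, map_sub, sub_nonneg] at h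

theorem abs_apply_le_apply_abs_of_dual_nonneg (hg : 0 ≤ g) (y : E) : |g y| ≤ g |y| :=
  abs_le'.2 ⟨monotone_of_dual_nonneg hg (le_abs_self y),
    map_neg g y ▸ monotone_of_dual_nonneg hg (neg_le_abs y)⟩

variable [HasSolidNorm E]

theorem abs_eq_self_of_dual_nonneg (hg : 0 ≤ g) : |g| = g := by
  refine sup_eq_left.2 fun y hy => ?_
  have h : 0 ≤ g y := hg y hy
  rw [neg_apply]
  linarith

theorem dual_norm_le_norm_of_nonneg_of_le (hg : 0 ≤ g) (hgh : g ≤ h) : ‖g‖ ≤ ‖h‖ := by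
  refine g.opNorm_le_bound (norm_nonneg h) fun y => ?_
  calc |g y| ≤ g |y| := abs_apply_le_apply_abs_of_dual_nonneg hg y
    _ ≤ h |y| := hgh |y| (abs_nonneg y)
    _ ≤ ‖h‖ * ‖|y|‖ := (Real.le_norm_self _).trans (h.le_opNorm _)
    _ = ‖h‖ * ‖y‖ := by rw [norm_abs_eq_norm]

theorem exists_dual_nonneg_norming (hu : 0 ≤ u) :
    ∃ h : StrongDual ℝ E, 0 ≤ h ∧ ‖h‖ ≤ 1 ∧ ‖u‖ ≤ h u := by
  obtain ⟨f, hf, hfu⟩ := exists_dual_vector'' ℝ u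
  refine ⟨f.positivePart, fun y hy => ?_, ?_, ?_⟩
  · rw [StrongDual.positivePart_apply f hy]
    exact StrongDual.posSup_nonneg f hy
  · exact (ContinuousLinearMap.opNorm_le_bound _ (norm_nonneg f)
      (StrongDual.abs_posPartAddHom_le f)).trans hf
  · rw [StrongDual.positivePart_apply f hu]
    exact hfu.ge.trans (StrongDual.le_posSup f hu le_rfl)

theorem exists_dual_eqOn_nonneg {φ : E → ℝ} {M : ℝ} (hM : 0 ≤ M)
    (hadd : ∀ a b, 0 ≤ a → 0 ≤ b → φ (a + b) = φ a + φ b)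
    (hφ : ∀ a, 0 ≤ a → |φ a| ≤ M * ‖a‖) :
    ∃ g : StrongDual ℝ E, ∀ a, 0 ≤ a → g a = φ a := by
  let T : E →+ ℝ := AddMonoidHom.mk' (fun x => φ x⁺ - φ x⁻) fun x y => by
    have hparts : (x + y)⁺ + (x⁻ + y⁻) = (x⁺ + y⁺) + (x + y)⁻ := by
      rw [← sub_eq_sub_iff_add_eq_add, posPart_sub_negPart, add_sub_add_comm,
        posPart_sub_negPart, posPart_sub_negPart]
    have hφparts := congrArg φ hparts
    simp only [hadd, posPart_nonneg, negPart_nonneg, add_nonneg] at hφparts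
    linarith
  have hT : ∀ x, ‖T x‖ ≤ (2 * M) * ‖x‖ := fun x => by
    calc ‖T x‖ ≤ |φ x⁺| + |φ x⁻| := norm_sub_le _ _
      _ ≤ M * ‖x⁺‖ + M * ‖x⁻‖ := add_le_add (hφ _ (posPart_nonneg x)) (hφ _ (negPart_nonneg x))
      _ ≤ M * ‖x‖ + M * ‖x‖ := by
        gcongr
        exacts [norm_posPart_le_norm x, norm_negPart_le_norm x]
      _ = (2 * M) * ‖x‖ := by ring
  refine ⟨T.toRealLinearMap (AddMonoidHomClass.continuous_of_bound T _ hT), fun a ha => ?_⟩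
  have hφ0 : φ 0 = 0 := by simpa using hadd 0 0 le_rfl le_rfl
  change φ a⁺ - φ a⁻ = φ a
  rw [posPart_of_nonneg ha, negPart_of_nonneg ha, hφ0, sub_zero]

end PositiveFunctional

section BandComponent

variable {E : Type*} [NormedAddCommGroup E] [NormedSpace ℝ E] [Lattice E]
  {f g h : StrongDual ℝ E} {u v y : E}

/-- The functional `g` is carried by the band generated by `u ≥ 0`: its value at a positive `y` is
the limit of its values at the truncations `y ⊓ k • u`. -/
def IsCarriedBy (g : StrongDual ℝ E) (u : E) : Prop :=
  ∀ y, 0 ≤ y → Tendsto (fun k : ℕ => g (y ⊓ k • u)) atTop (𝓝 (g y))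

variable [IsOrderedAddMonoid E]

theorem IsCarriedBy.apply_eq_zero (hg : IsCarriedBy g u) (h : y ⊓ u = 0) : g y = 0 := by
  refine tendsto_nhds_unique (hg y (h ▸ inf_le_left)) ?_
  simp only [inf_nsmul_eq_zero h, map_zero, tendsto_const_nhds]

/-- `sup_k h (y ⊓ k • u)`, the value at `y ≥ 0` of the component of the positive functional `h`
which is carried by the band generated by `u ≥ 0`. -/
noncomputable def bandComponent (h : StrongDual ℝ E) (u y : E) : ℝ := ⨆ k : ℕ, h (y ⊓ k • u)

theorem bandComponent_le (hh : 0 ≤ h) : bandComponent h u y ≤ h y :=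
  ciSup_le fun _ => monotone_of_dual_nonneg hh inf_le_left

theorem le_bandComponent (hh : 0 ≤ h) (k : ℕ) : h (y ⊓ k • u) ≤ bandComponent h u y :=
  le_ciSup (f := fun k : ℕ => h (y ⊓ k • u))
    ⟨h y, forall_mem_range.2 fun _ => monotone_of_dual_nonneg hh inf_le_left⟩ k

theorem bandComponent_nonneg (hh : 0 ≤ h) (hy : 0 ≤ y) : 0 ≤ bandComponent h u y := by
  simpa [inf_eq_right.2 hy] using le_bandComponent (u := u) (y := y) hh 0

theorem bandComponent_of_le_nsmul (hh : 0 ≤ h) {k : ℕ} (hy : y ≤ k • u) :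
    bandComponent h u y = h y := by
  refine (bandComponent_le hh).antisymm ?_
  simpa only [inf_eq_left.2 hy] using le_bandComponent (u := u) (y := y) hh k

theorem tendsto_bandComponent (hh : 0 ≤ h) (hu : 0 ≤ u) :
    Tendsto (fun k : ℕ => h (y ⊓ k • u)) atTop (𝓝 (bandComponent h u y)) :=
  tendsto_atTop_ciSup
    (fun _ _ hij => monotone_of_dual_nonneg hh (inf_le_inf_left y (nsmul_le_nsmul_left hu hij)))
    ⟨h y, forall_mem_range.2 fun _ => monotone_of_dual_nonneg hh inf_le_left⟩

theorem bandComponent_add (hh : 0 ≤ h) (hu : 0 ≤ u) {a b : E} (ha : 0 ≤ a) (hb : 0 ≤ b) :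
    bandComponent h u (a + b) = bandComponent h u a + bandComponent h u b := by
  apply le_antisymm
  · refine ciSup_le fun k => ?_
    have htrunc : (a + b) ⊓ k • u ≤ a ⊓ k • u + b ⊓ k • u := by
      simpa only [inf_comm] using inf_add_le_inf_add_inf (nsmul_nonneg hu k) ha hb
    calc h ((a + b) ⊓ k • u) ≤ h (a ⊓ k • u) + h (b ⊓ k • u) :=
          map_add h _ _ ▸ monotone_of_dual_nonneg hh htrunc
      _ ≤ _ := add_le_add (le_bandComponent hh k) (le_bandComponent hh k)
  · refine le_of_tendsto'
      ((tendsto_bandComponent hh hu).add (tendsto_bandComponent hh hu)) fun k => ?_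
    have htrunc : a ⊓ k • u + b ⊓ k • u ≤ (a + b) ⊓ (k + k) • u :=
      le_inf (add_le_add inf_le_left inf_le_left)
        (add_nsmul u k k ▸ add_le_add inf_le_right inf_le_right)
    calc h (a ⊓ k • u) + h (b ⊓ k • u) ≤ h ((a + b) ⊓ (k + k) • u) :=
          map_add h _ _ ▸ monotone_of_dual_nonneg hh htrunc
      _ ≤ _ := le_bandComponent hh (k + k)

variable [HasSolidNorm E]

theorem exists_le_isCarriedBy (hh : 0 ≤ h) (hu : 0 ≤ u) :
    ∃ g : StrongDual ℝ E, 0 ≤ g ∧ g ≤ h ∧ g u = h u ∧ IsCarriedBy g u := by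
  obtain ⟨g, hg⟩ := exists_dual_eqOn_nonneg (φ := bandComponent h u) (norm_nonneg h)
    (fun a b ha hb => bandComponent_add hh hu ha hb) fun a ha => by
      rw [abs_of_nonneg (bandComponent_nonneg hh ha)]
      exact (bandComponent_le hh).trans ((Real.le_norm_self _).trans (h.le_opNorm a))
  refine ⟨g, fun y hy => ?_, fun y hy => ?_, ?_, fun y hy => ?_⟩
  · exact (bandComponent_nonneg hh hy).trans_eq (hg y hy).symm
  · exact (hg y hy).trans_le (bandComponent_le hh)
  · exact (hg u hu).trans (bandComponent_of_le_nsmul hh (one_nsmul u).ge)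
  · rw [hg y hy]
    refine (tendsto_bandComponent hh hu).congr fun k => ?_
    rw [hg _ (le_inf hy (nsmul_nonneg hu k)), bandComponent_of_le_nsmul hh inf_le_right]

theorem exists_norming_isCarriedBy (hu : 0 ≤ u) :
    ∃ g : StrongDual ℝ E, 0 ≤ g ∧ ‖g‖ ≤ 1 ∧ ‖u‖ ≤ g u ∧ IsCarriedBy g u := by
  obtain ⟨h, hh, hh1, hhu⟩ := exists_dual_nonneg_norming hu
  obtain ⟨g, hg, hgh, hgu, hcarried⟩ := exists_le_isCarriedBy hh hu
  exact ⟨g, hg, (dual_norm_le_norm_of_nonneg_of_le hg hgh).trans hh1, hhu.trans_eq hgu.symm,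
    hcarried⟩

theorem IsCarriedBy.inf_eq_zero (hfu : IsCarriedBy f u) (hgv : IsCarriedBy g v) (hf : 0 ≤ f)
    (hg : 0 ≤ g) (huv : u ⊓ v = 0) : f ⊓ g = 0 := by
  have hu : 0 ≤ u := huv ▸ inf_le_left
  have hv : 0 ≤ v := huv ▸ inf_le_right
  refine le_antisymm (fun y hy => ?_) (le_inf hf hg)
  have hlim : Tendsto (fun k : ℕ => f y - f (y ⊓ k • u)) atTop (𝓝 0) := by
    simpa only [sub_self] using (hfu y hy).const_sub (f y)
  refine ge_of_tendsto' hlim fun k => ?_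
  -- Split `y` into its truncation `z`, on which `g` vanishes, and the remainder.
  set z := y ⊓ k • u
  have hz : 0 ≤ z := le_inf hy (nsmul_nonneg hu k)
  have hgz : g z = 0 := hgv.apply_eq_zero <|
    inf_eq_zero_of_le_of_le hz hv inf_le_right le_rfl
      (nsmul_inf_eq_zero huv k)
  calc (f ⊓ g) y = (f ⊓ g) (y - z) + (f ⊓ g) z := by rw [map_sub, sub_add_cancel]
    _ ≤ f (y - z) + g z := add_le_add
        ((inf_le_left : f ⊓ g ≤ f) _ (sub_nonneg.2 inf_le_left))
        ((inf_le_right : f ⊓ g ≤ g) _ hz)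
    _ = f y - f z := by rw [map_sub, hgz, add_zero]

theorem isWeaklySummable_of_isCarriedBy {p : ℝ} (hp : 0 < p) (hE : HasLowerEstimate E p)
    {u : ℕ → E} {g : ℕ → StrongDual ℝ E} (hu0 : ∀ n, 0 ≤ u n)
    (hu : Pairwise fun m n => u m ⊓ u n = 0) (hg0 : ∀ n, 0 ≤ g n) (hg1 : ∀ n, ‖g n‖ ≤ 1)
    (hgu : ∀ n, IsCarriedBy (g n) (u n)) : IsWeaklySummable p g := by
  obtain ⟨C, hC, hCE⟩ := hE.exists_sum_rpow_norm_le hp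
  refine isWeaklySummable_of_sum_rpow_le hp hC.le fun N y => ?_
  have hz : ∀ k n, 0 ≤ |y| ⊓ k • u n := fun k n => le_inf (abs_nonneg y) (nsmul_nonneg (hu0 n) k)
  have hlim : Tendsto (fun k : ℕ => ∑ n : Fin N, g n (|y| ⊓ k • u n) ^ p) atTop
      (𝓝 (∑ n : Fin N, g n |y| ^ p)) :=
    tendsto_finsetSum _ fun n _ => (hgu n |y| (abs_nonneg y)).rpow_const (Or.inr hp.le)
  calc ∑ n : Fin N, |g n y| ^ p ≤ ∑ n : Fin N, g n |y| ^ p := by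
        gcongr with n
        exact abs_apply_le_apply_abs_of_dual_nonneg (hg0 n) y
    _ ≤ (C * ‖y‖) ^ p := le_of_tendsto' hlim fun k => ?_
  calc ∑ n : Fin N, g n (|y| ⊓ k • u n) ^ p ≤ ∑ n : Fin N, ‖|y| ⊓ k • u n‖ ^ p := by
        gcongr with n
        · exact hg0 n _ (hz k n)
        · exact (Real.le_norm_self _).trans
            (((g n).le_of_opNorm_le (hg1 n) _).trans_eq (one_mul _))
    _ ≤ (C * ‖|y|‖) ^ p := by
        refine hCE N (fun n => |y| ⊓ k • u n) |y| (abs_nonneg y) (fun n => hz k n)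
          (fun n => inf_le_left) fun m n hmn => ?_
        exact inf_eq_zero_of_le_of_le (hz k m) (hz k n) inf_le_right inf_le_right
          (nsmul_inf_nsmul_eq_zero (hu (Fin.val_injective.ne hmn)) k)
    _ = (C * ‖y‖) ^ p := by rw [norm_abs_eq_norm]

end BandComponent

section DisjointDPP

variable {E : Type*} [NormedAddCommGroup E] [NormedSpace ℝ E] [Lattice E] [HasSolidNorm E]
  [IsOrderedAddMonoid E] {p : ℝ} {x : ℕ → E}

theorem tendsto_posPart_zero (hp : 0 < p) (hE : HasLowerEstimate E p)
    (hdual : HasDisjointDPP p (StrongDual ℝ E)) (hd : IsDisjointSeq x)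
    (hx : IsWeaklySummable p x) : Tendsto (fun n => (x n)⁺) atTop (𝓝 0) := by
  have hu0 : ∀ n, 0 ≤ (x n)⁺ := fun n => posPart_nonneg _
  have hu : Pairwise fun m n => (x m)⁺ ⊓ (x n)⁺ = 0 := fun m n hmn =>
    inf_eq_zero_of_le_of_le (hu0 m) (hu0 n) (posPart_le_abs _) (posPart_le_abs _) (hd m n hmn)
  choose g hg0 hg1 hnorming hcarried using fun n => exists_norming_isCarriedBy (hu0 n)
  have hgd : IsDisjointSeq g := fun m n hmn => by
    rw [abs_eq_self_of_dual_nonneg (hg0 m), abs_eq_self_of_dual_nonneg (hg0 n)]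
    exact (hcarried m).inf_eq_zero (hcarried n) (hg0 m) (hg0 n) (hu hmn)
  have hgs : IsWeaklySummable p g := isWeaklySummable_of_isCarriedBy hp hE hu0 hu hg0 hg1 hcarried
  have hunif := hdual g hgd hgs _ (hx.isWeaklyNull_inclusionInDoubleDual hp)
  have happly : ∀ n, g n (x n)⁺ = g n (x n) := fun n => by
    have hneg : g n (x n)⁻ = 0 :=
      (hcarried n).apply_eq_zero (inf_comm (x n)⁺ _ ▸ posPart_inf_negPart_eq_zero (x n))
    nth_rw 2 [← posPart_sub_negPart (x n)]
    rw [map_sub, hneg, sub_zero]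
  rw [Metric.tendsto_nhds]
  intro ε hε
  filter_upwards [Metric.tendstoUniformlyOn_iff.1 hunif ε hε] with n hn
  calc dist (x n)⁺ 0 = ‖(x n)⁺‖ := dist_zero_right _
    _ ≤ g n (x n) := (hnorming n).trans_eq (happly n)
    _ ≤ dist 0 (g n (x n)) := dist_zero_left (g n (x n)) ▸ Real.le_norm_self _
    _ < ε := hn (g n) (mem_range_self n)

theorem tendsto_zero_of_isWeaklySummable (hp : 0 < p) (hE : HasLowerEstimate E p)
    (hdual : HasDisjointDPP p (StrongDual ℝ E)) (hd : IsDisjointSeq x)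
    (hx : IsWeaklySummable p x) : Tendsto x atTop (𝓝 0) := by
  have hpos := tendsto_posPart_zero hp hE hdual hd hx
  have hneg := tendsto_posPart_zero hp hE hdual (x := fun n => -x n)
    (fun m n hmn => by simpa only [abs_neg] using hd m n hmn)
    (fun f => by simpa only [map_neg, abs_neg] using hx f)
  simpa only [posPart_neg, posPart_sub_negPart, sub_zero] using hpos.sub hneg

theorem proposition2p4_general (hp : 0 < p) (hE : HasLowerEstimate E p)
    (hdual : HasDisjointDPP p (StrongDual ℝ E)) : HasDisjointDPP p E := fun _ hd hx =>
  isDunfordPettisSet_range_of_tendsto_zero (tendsto_zero_of_isWeaklySummable hp hE hdual hd hx)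

end DisjointDPP

theorem proposition2p4 {E : Type*} [NormedAddCommGroup E] [NormedSpace ℝ E] [CompleteSpace E]
    [Lattice E] [HasSolidNorm E] [IsOrderedAddMonoid E] [IsOrderedModule ℝ E]
    (p : ℝ) (hp : 2 ≤ p) (hcotype : HasCotype E p)
    (hdual : HasDisjointDPP p (StrongDual ℝ E)) :
    HasDisjointDPP p E :=
  proposition2p4_general (by linarith) hcotype.hasLowerEstimate hdual
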